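/- Let $(M,J)$ be an almost complex manifold of real dimension $2n$, i.e. a smooth manifold with a smooth endomorphism $J$ of $TM$, $J^2=-1$, and let $U\subseteq M$ be open. A smooth function $f:U\to\mathbb C$ is called almost holomorphic if $J^*df=i\,df$ (where $(J^*\omega)(X)=\omega(JX)$). A maximal system on $U$ is a sequence $(f_1,\dots,f_m)$ of almost holomorphic functions on $U$ whose differentials are $\mathbb C$-linearly independent at each point of $U$ and such that for every almost holomorphic function $g$ on $U$ the functions $f_1,\dots,f_m,g$ are functionally dependent on $U$, i.e. $df_1\wedge\dots\wedge df_m\wedge dg=0$ on $U$. Let $f=(f_1,\dots,f_m)$ and $h=(h_1,\dots,h_m)$ be two maximal systems on $U$, and suppose that $f$ can be completed by smooth functions $z^{m+1},\dots,z^n:U\to\mathbb C$ to a diffeomorphism $(f_1,\dots,f_m,z^{m+1},\dots,z^n)$ of $U$ onto an open subset of $\mathbb C^n$ (a local Spencer coordinate system of type $m$). For an open set $V\subseteq U$, a holomorphic transition on $V$ between the coordinates $w=(w^1,\dots,w^m)=f$ and $v=(v^1,\dots,v^m)=h$ is a bijective holomorphic mapping $H$, with holomorphic inverse, from $f(V)$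 onto $h(V)$ such that $h=H\circ f$ on $V$, where $f(V)$ and $h(V)$ are open in $\mathbb C^m$. Then: (i) for every open $V\subseteq U$ (in particular $V=U$, where $f(U)=U_m^c$ is the $m$-dimensional open set associated with the system) such that all level sets of $f|_V$ and of $h|_V$ are connected, there is a holomorphic transition on $V$; (ii) every point of $U$ has arbitrarily small open neighbourhoods $V\subseteq U$ such that all level sets of $f|_V$ and of $h|_V$ are connected, and there is a holomorphic transition on each of them. -/

import Mathlib

open Set Topology
open scoped Manifold ContDiff

/-- An almost complex structure on a smooth manifold `M` of real dimension `2 * n`: a smooth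
endomorphism `J` of the tangent bundle with `J ^ 2 = -1`. -/
structure AlmostComplexStructure (n : ℕ) (M : Type*) [TopologicalSpace M]
    [ChartedSpace (EuclideanSpace ℝ (Fin (2 * n))) M] [IsManifold (𝓡 (2 * n)) ∞ M] where
  /-- The endomorphism of each tangent space. -/
  toEnd : ∀ p : M, TangentSpace (𝓡 (2 * n)) p →L[ℝ] TangentSpace (𝓡 (2 * n)) p
  toEnd_toEnd : ∀ (p : M) (v : TangentSpace (𝓡 (2 * n)) p), toEnd p (toEnd p v) = -v
  contMDiff_toEnd : ContMDiff (𝓡 (2 * n))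
    ((𝓡 (2 * n)).prod
      𝓘(ℝ, EuclideanSpace ℝ (Fin (2 * n)) →L[ℝ] EuclideanSpace ℝ (Fin (2 * n)))) ∞
    (fun p : M => Bundle.TotalSpace.mk'
      (EuclideanSpace ℝ (Fin (2 * n)) →L[ℝ] EuclideanSpace ℝ (Fin (2 * n)))
      (E := fun q : M => TangentSpace (𝓡 (2 * n)) q →L[ℝ] TangentSpace (𝓡 (2 * n)) q)
      p (toEnd p))

section

variable {n m k : ℕ} {M : Type*} [TopologicalSpace M]
  [ChartedSpace (EuclideanSpace ℝ (Fin (2 * n))) M]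

/-- The differential `d_p f` of a complex-valued function, a complex-valued real-linear form on
the tangent space (these forms are a complex vector space). -/
noncomputable def cdiff (f : M → ℂ) (p : M) : TangentSpace (𝓡 (2 * n)) p →L[ℝ] ℂ :=
  mfderiv (𝓡 (2 * n)) 𝓘(ℝ, ℂ) f p

/-- The functions `f 0, …, f (k - 1)` are functionally independent on `U`: their differentials
are `ℂ`-linearly independent at each point of `U`. -/
def FunctionallyIndependentOn (f : Fin k → M → ℂ) (U : Set M) : Prop :=
  ∀ p ∈ U, LinearIndependent ℂ (fun j => cdiff (n := n) (f j) p)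

/-- The functions `f 0, …, f (k - 1)` are functionally dependent on `U`: their differentials
are `ℂ`-linearly dependent at each point of `U` (that is, `df 0 ∧ … ∧ df (k - 1) = 0` on `U`). -/
def FunctionallyDependentOn (f : Fin k → M → ℂ) (U : Set M) : Prop :=
  ∀ p ∈ U, ¬ LinearIndependent ℂ (fun j => cdiff (n := n) (f j) p)

variable [IsManifold (𝓡 (2 * n)) ∞ M]

/-- `f` is smooth on `U` and `J^* df = i df` there. Only the values of `f` on the open set `U`
matter. -/
def AlmostHolomorphicOn (J : AlmostComplexStructure n M) (f : M → ℂ) (U : Set M) : Prop :=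
  ContMDiffOn (𝓡 (2 * n)) 𝓘(ℝ, ℂ) ∞ f U ∧
    ∀ p ∈ U, ∀ v : TangentSpace (𝓡 (2 * n)) p,
      cdiff f p (J.toEnd p v) = Complex.I * cdiff f p v

/-- `(f 0, …, f (m - 1))` is a maximal sequence of functionally independent almost holomorphic
functions on `U`: adjoining any almost holomorphic function on `U` makes it functionally
dependent. -/
structure IsMaximalSystem (J : AlmostComplexStructure n M) (U : Set M) (f : Fin m → M → ℂ) :
    Prop where
  almostHolomorphicOn : ∀ j, AlmostHolomorphicOn J (f j) U
  independent : FunctionallyIndependentOn (n := n) f U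
  maximal : ∀ g : M → ℂ, AlmostHolomorphicOn J g U →
    FunctionallyDependentOn (n := n) (Fin.snoc (α := fun _ => M → ℂ) f g) U

/-- `(f 0, …, f (m - 1))` defines a local Spencer coordinate system of type `m` on `U`: it is a
maximal system, and it can be completed by further smooth complex functions to smooth complex
coordinates `φ = (w^1, …, w^m, z^{m+1}, …, z^n)` on `U`, a diffeomorphism from `U` onto an open
subset of `ℂⁿ`; together with the complex conjugates these are self-conjugate coordinates. -/
structure IsSpencerSystem (J : AlmostComplexStructure n M) (U : Set M) (f : Fin m → M → ℂ) :
    Prop extends IsMaximalSystem J U f where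
  exists_coordinates : ∃ (hmn : m ≤ n) (φ : OpenPartialHomeomorph M (Fin n → ℂ)),
    φ.source = U ∧
    ContMDiffOn (𝓡 (2 * n)) 𝓘(ℝ, Fin n → ℂ) ∞ φ U ∧
    ContMDiffOn 𝓘(ℝ, Fin n → ℂ) (𝓡 (2 * n)) ∞ φ.symm φ.target ∧
    ∀ p ∈ U, ∀ j : Fin m, φ p (Fin.castLE hmn j) = f j p

end

/-- The mapping `f_U = (f 0, …, f (m - 1))` into `ℂᵐ`; the open set `U_m^c` is its image of
`U`. -/
def jointMap {m : ℕ} {M : Type*} (f : Fin m → M → ℂ) (p : M) : Fin m → ℂ := fun j => f j p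

/-- Every level set of `F` in `V` is connected (or empty). -/
def HasConnectedLevelSets {X Y : Type*} [TopologicalSpace X] (F : X → Y) (V : Set X) : Prop :=
  ∀ c : Y, IsPreconnected (V ∩ F ⁻¹' {c})

/-- `H` is a bijective holomorphic mapping, with holomorphic inverse, from the open set `F '' V`
onto the open set `G '' V` of `ℂᵐ`, and it is the transition from the coordinates `w = F` to the
coordinates `v = G`, that is, `G = H ∘ F` on `V`. -/
structure IsHolomorphicTransition {m : ℕ} {X : Type*} (F G : X → (Fin m → ℂ)) (V : Set X)
    (H : (Fin m → ℂ) → (Fin m → ℂ)) : Prop where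
  isOpen_source : IsOpen (F '' V)
  isOpen_target : IsOpen (G '' V)
  bijOn : BijOn H (F '' V) (G '' V)
  holomorphic : DifferentiableOn ℂ H (F '' V)
  holomorphic_inverse : ∃ K : (Fin m → ℂ) → (Fin m → ℂ),
    InvOn K H (F '' V) (G '' V) ∧ DifferentiableOn ℂ K (G '' V)
  transition : ∀ p ∈ V, G p = H (F p)

/-! Maximality of `f` puts each `dh_j` in the complex span of the `df_k`, and independence of the
`dh_j` makes the coefficient matrix invertible. In Spencer coordinates the derivative of `h` is
therefore `A ∘ π`, with `π` the projection to the first `m` coordinates and `A` complex linear and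
invertible. So locally `h` is a function of `f` alone, and that function is biholomorphic by the
inverse function theorem (`exists_biholomorphic_factorization`). Hence `h` is locally constant on
level sets of `f`, and conversely; connected level sets let the local transitions glue
(`exists_isHolomorphicTransition`). Coordinate balls give the small neighbourhoods of (ii). -/

/-! ### Local factorization through a linear projection -/

theorem eq_of_hasFDerivAt_comp_of_convex {E F : Type*} [NormedAddCommGroup E] [NormedSpace ℝ E]
    [NormedAddCommGroup F] [NormedSpace ℝ F] {g : E → F} {π : E →L[ℝ] F} {s : Set E}
    (hs : Convex ℝ s) (hg : ∀ z ∈ s, ∃ A : F →L[ℝ] F, HasFDerivAt g (A ∘L π) z)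
    {x y : E} (hx : x ∈ s) (hy : y ∈ s) (hxy : π x = π y) : g x = g y := by
  have key : ∀ t ∈ Icc (0 : ℝ) 1,
      HasDerivAt (fun t : ℝ => g (AffineMap.lineMap x y t)) 0 t := by
    intro t ht
    obtain ⟨A, hA⟩ := hg _ (hs.lineMap_mem hx hy ht)
    have h := hA.comp_hasDerivAt t (AffineMap.hasDerivAt_lineMap (a := x) (b := y) (x := t))
    -- The segment from `x` to `y` runs along the kernel of `π`.
    have h0 : (A ∘L π) (y - x) = 0 := by simp [hxy]
    rw [h0] at h
    exact h
  have h := constant_of_has_deriv_right_zero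
    (f := fun t : ℝ => g (AffineMap.lineMap x y t)) (a := 0) (b := 1)
    (fun t ht => (key t ht).continuousAt.continuousWithinAt)
    (fun t ht => (key t (Ico_subset_Icc_self ht)).hasDerivWithinAt) 1 (by simp)
  simpa using h.symm

/-- A homeomorphism between open sets that is holomorphic together with its inverse. -/
structure IsBiholomorphic {F : Type*} [NormedAddCommGroup F] [NormedSpace ℂ F]
    (e : OpenPartialHomeomorph F F) : Prop where
  differentiableOn : DifferentiableOn ℂ e e.source
  differentiableOn_symm : DifferentiableOn ℂ e.symm e.target

theorem IsBiholomorphic.symm {F : Type*} [NormedAddCommGroup F] [NormedSpace ℂ F]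
    {e : OpenPartialHomeomorph F F} (he : IsBiholomorphic e) : IsBiholomorphic e.symm :=
  ⟨he.differentiableOn_symm, by simpa using he.differentiableOn⟩

theorem exists_biholomorphic_factorization {E F : Type*} [NormedAddCommGroup E] [NormedSpace ℝ E]
    [NormedAddCommGroup F] [NormedSpace ℝ F] [NormedSpace ℂ F] [IsScalarTower ℝ ℂ F]
    [CompleteSpace F] {g : E → F} {π : E →L[ℝ] F} {ι : F →L[ℝ] E} (hι : ∀ w, π (ι w) = w)
    {T : Set E} (hT : IsOpen T) (hg : ContDiffOn ℝ ∞ g T)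
    (hg' : ∀ z ∈ T, ∃ A : F ≃L[ℂ] F,
      HasFDerivAt g ((A : F →L[ℂ] F).restrictScalars ℝ ∘L π) z)
    {z₀ : E} (hz₀ : z₀ ∈ T) :
    ∃ e : OpenPartialHomeomorph F F, IsBiholomorphic e ∧ ∀ᶠ z in 𝓝 z₀, π z ∈ e.source ∧
      g z = e (π z) := by
  -- Affine section of `π` through `z₀`; the derivative of `g ∘ s` is `A` itself, so the factor
  -- sought is `g ∘ s`.
  set s : F → E := fun w => z₀ + ι (w - π z₀) with hs
  have hsc : Continuous s := by fun_prop
  have hs₀ : s (π z₀) = z₀ := by simp [hs]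
  have hs' : ∀ w, HasFDerivAt s ι w := fun w =>
    ((ι.hasFDerivAt (x := w - π z₀)).comp w ((hasFDerivAt_id w).sub_const _)).const_add z₀
  have hπs : ∀ w, π (s w) = w := fun w => by simp [hs, hι]
  have hgs : ∀ w, s w ∈ T → ∃ A : F ≃L[ℂ] F,
      HasFDerivAt (g ∘ s) ((A : F →L[ℂ] F).restrictScalars ℝ) w := by
    intro w hw
    obtain ⟨A, hA⟩ := hg' _ hw
    refine ⟨A, ?_⟩
    have := hA.comp w (hs' w)
    convert this using 1
    ext v
    simp [hι]
  have hcd : ContDiffAt ℝ ∞ (g ∘ s) (π z₀) := by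
    refine ContDiffAt.comp _ ?_ ?_
    · rw [hs₀]; exact hg.contDiffAt (hT.mem_nhds hz₀)
    · fun_prop
  obtain ⟨A₀, hA₀⟩ := hgs (π z₀) (by rwa [hs₀])
  have hA₀' : HasFDerivAt (g ∘ s) ((A₀.restrictScalars ℝ : F ≃L[ℝ] F) : F →L[ℝ] F) (π z₀) := hA₀
  let e₀ := hcd.toOpenPartialHomeomorph (g ∘ s) hA₀' (by simp)
  -- Shrinking the source makes the derivative of `e` complex linear and invertible at each of its
  -- points, not only at `π z₀`.
  let e := e₀.restrOpen (s ⁻¹' T) (hT.preimage hsc)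
  have hesrc : e.source ⊆ s ⁻¹' T := fun w hw => by
    have : w ∈ e₀.source ∩ s ⁻¹' T := by simpa [e] using hw
    exact this.2
  have hecoe : ∀ w, e w = g (s w) := fun w => rfl
  have hd : ∀ w ∈ e.source, ∃ A : F ≃L[ℂ] F, HasFDerivAt e (A : F →L[ℂ] F) w := by
    intro w hw
    obtain ⟨A, hA⟩ := hgs w (hesrc hw)
    exact ⟨A, hasFDerivAt_of_restrictScalars ℝ hA rfl⟩
  have hmem : π z₀ ∈ e.source := by
    have h1 : π z₀ ∈ e₀.source := hcd.mem_toOpenPartialHomeomorph_source hA₀' (by simp)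
    have h2 : π z₀ ∈ s ⁻¹' T := by simpa [hs₀] using hz₀
    simpa [e] using And.intro h1 h2
  refine ⟨e, ⟨fun w hw => ?_, fun y hy => ?_⟩, ?_⟩
  · obtain ⟨A, hA⟩ := hd w hw
    exact hA.differentiableAt.differentiableWithinAt
  · obtain ⟨A, hA⟩ := hd _ (e.map_target hy)
    exact (e.hasFDerivAt_symm hy hA).differentiableAt.differentiableWithinAt
  · obtain ⟨r, hr, hrT⟩ := Metric.isOpen_iff.1 hT z₀ hz₀
    have h1 : ∀ᶠ z in 𝓝 z₀, π z ∈ e.source :=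
      π.continuous.continuousAt.eventually (e.open_source.mem_nhds hmem)
    have h2 : ∀ᶠ z in 𝓝 z₀, s (π z) ∈ Metric.ball z₀ r := by
      have : ContinuousAt (fun z => s (π z)) z₀ := (hsc.comp π.continuous).continuousAt
      refine this.eventually ?_
      simp only [hs₀]
      exact Metric.ball_mem_nhds _ hr
    filter_upwards [h1, h2, Metric.ball_mem_nhds z₀ hr] with z hz1 hz2 hz3
    refine ⟨hz1, ?_⟩
    rw [hecoe]
    -- `z` and `s (π z)` lie over the same point and in one ball inside `T`.
    refine eq_of_hasFDerivAt_comp_of_convex (convex_ball z₀ r) (π := π) (fun y hy => ?_) hz3 hz2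
      (hπs _).symm
    obtain ⟨A, hA⟩ := hg' y (hrT hy)
    exact ⟨_, hA⟩

/-- Near `p`, the map `G` is a biholomorphic function of `F`. -/
def BiholomorphicallyRelatedAt {X E : Type*} [TopologicalSpace X] [NormedAddCommGroup E]
    [NormedSpace ℂ E] (F G : X → E) (p : X) : Prop :=
  ∃ e : OpenPartialHomeomorph E E, IsBiholomorphic e ∧
    ∀ᶠ q in 𝓝 p, F q ∈ e.source ∧ G q = e (F q)

/-! ### From local relations to a global transition -/

namespace BiholomorphicallyRelatedAt

variable {X E : Type*} [TopologicalSpace X] [NormedAddCommGroup E] [NormedSpace ℂ E]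
  {F G : X → E} {p : X} {V : Set X}

theorem symm (hp : BiholomorphicallyRelatedAt F G p) : BiholomorphicallyRelatedAt G F p := by
  obtain ⟨e, he, h⟩ := hp
  refine ⟨e.symm, he.symm, h.mono fun q hq => ?_⟩
  rw [hq.2]
  exact ⟨e.map_source hq.1, (e.left_inv hq.1).symm⟩

theorem map_nhds_eq (hp : BiholomorphicallyRelatedAt F G p) (hF : Filter.map F (𝓝 p) = 𝓝 (F p)) :
    Filter.map G (𝓝 p) = 𝓝 (G p) := by
  obtain ⟨e, -, h⟩ := hp
  have hG : G =ᶠ[𝓝 p] e ∘ F := h.mono fun q hq => hq.2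
  rw [Filter.map_congr hG, hG.eq_of_nhds, ← Filter.map_map, hF, Function.comp_apply,
    e.map_nhds_eq h.self_of_nhds.1]

/-- Since `G = e ∘ F` near each point, `G` is locally constant on the level sets of `F` in `V`,
which are connected. -/
theorem eq_of_eq (hV : ∀ p ∈ V, BiholomorphicallyRelatedAt F G p)
    (hF : HasConnectedLevelSets F V) {p q : X} (hp : p ∈ V) (hq : q ∈ V) (hpq : F p = F q) :
    G p = G q := by
  refine (hF (F q)).induction₂ (fun x y => G x = G y) ?_ (fun _ _ _ _ _ _ => Eq.trans)
    (fun _ _ _ _ => Eq.symm) ⟨hp, hpq⟩ ⟨hq, rfl⟩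
  rintro x ⟨hx, hxc⟩
  obtain ⟨e, -, h⟩ := hV x hx
  filter_upwards [nhdsWithin_le_nhds h, self_mem_nhdsWithin] with y hy hyc
  have hxy : F x = F y := hxc.trans hyc.2.symm
  rw [h.self_of_nhds.2, hy.2, hxy]

theorem differentiableOn_of_comp_eq (hV : ∀ p ∈ V, BiholomorphicallyRelatedAt F G p)
    (hVo : IsOpen V) (hF : ∀ p ∈ V, Filter.map F (𝓝 p) = 𝓝 (F p)) {H : E → E}
    (hH : ∀ p ∈ V, G p = H (F p)) : DifferentiableOn ℂ H (F '' V) := by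
  rintro _ ⟨p, hp, rfl⟩
  obtain ⟨e, he, h⟩ := hV p hp
  -- `F` sends neighbourhoods of `p` to neighbourhoods of `F p`, so agreement near `p` gives
  -- agreement near `F p`.
  have hHe : H =ᶠ[𝓝 (F p)] e := by
    rw [Filter.EventuallyEq, ← hF p hp, Filter.eventually_map]
    filter_upwards [h, hVo.mem_nhds hp] with q hq hqV
    rw [← hH q hqV, hq.2]
  have hd : DifferentiableAt ℂ e (F p) :=
    he.differentiableOn.differentiableAt (e.open_source.mem_nhds h.self_of_nhds.1)
  exact (hd.congr_of_eventuallyEq hHe).differentiableWithinAt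

theorem exists_differentiableOn (hV : ∀ p ∈ V, BiholomorphicallyRelatedAt F G p)
    (hVo : IsOpen V) (hF : ∀ p ∈ V, Filter.map F (𝓝 p) = 𝓝 (F p))
    (hFc : HasConnectedLevelSets F V) :
    ∃ H : E → E, DifferentiableOn ℂ H (F '' V) ∧ ∀ p ∈ V, G p = H (F p) := by
  rcases V.eq_empty_or_nonempty with rfl | ⟨p₀, -⟩
  · exact ⟨id, differentiableOn_id, by simp⟩
  have : Nonempty X := ⟨p₀⟩
  -- The choice of preimage is immaterial by `eq_of_eq`.
  have hH : ∀ p ∈ V, G p = (G ∘ Function.invFunOn F V) (F p) := fun p hp =>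
    eq_of_eq hV hFc hp (Function.invFunOn_mem ⟨p, hp, rfl⟩)
      (Function.invFunOn_eq (f := F) ⟨p, hp, rfl⟩).symm
  exact ⟨_, differentiableOn_of_comp_eq hV hVo hF hH, hH⟩

end BiholomorphicallyRelatedAt

theorem isOpen_image_of_map_nhds_eq {X Y : Type*} [TopologicalSpace X] [TopologicalSpace Y]
    {F : X → Y} {V : Set X} (hVo : IsOpen V) (hF : ∀ p ∈ V, Filter.map F (𝓝 p) = 𝓝 (F p)) :
    IsOpen (F '' V) := by
  rw [isOpen_iff_mem_nhds]
  rintro _ ⟨p, hp, rfl⟩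
  rw [← hF p hp]
  exact Filter.image_mem_map (hVo.mem_nhds hp)

/-- The relation is symmetric, so exchanging `F` and `G` yields the inverse; this is where the level
sets of `G` enter. -/
theorem exists_isHolomorphicTransition {m : ℕ} {X : Type*} [TopologicalSpace X]
    {F G : X → Fin m → ℂ} {V : Set X} (hVo : IsOpen V)
    (hV : ∀ p ∈ V, BiholomorphicallyRelatedAt F G p)
    (hF : ∀ p ∈ V, Filter.map F (𝓝 p) = 𝓝 (F p))
    (hFc : HasConnectedLevelSets F V) (hGc : HasConnectedLevelSets G V) :
    ∃ H : (Fin m → ℂ) → Fin m → ℂ, IsHolomorphicTransition F G V H := by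
  have hV' : ∀ p ∈ V, BiholomorphicallyRelatedAt G F p := fun p hp => (hV p hp).symm
  have hG : ∀ p ∈ V, Filter.map G (𝓝 p) = 𝓝 (G p) := fun p hp => (hV p hp).map_nhds_eq (hF p hp)
  obtain ⟨H, hHd, hH⟩ := BiholomorphicallyRelatedAt.exists_differentiableOn hV hVo hF hFc
  obtain ⟨K, hKd, hK⟩ := BiholomorphicallyRelatedAt.exists_differentiableOn hV' hVo hG hGc
  have hinv : InvOn K H (F '' V) (G '' V) := by
    constructor
    · rintro _ ⟨p, hp, rfl⟩
      rw [← hH p hp, ← hK p hp]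
    · rintro _ ⟨p, hp, rfl⟩
      rw [← hK p hp, ← hH p hp]
  refine ⟨H, isOpen_image_of_map_nhds_eq hVo hF, isOpen_image_of_map_nhds_eq hVo hG,
    hinv.bijOn ?_ ?_, hHd, ⟨K, hinv, hKd⟩, hH⟩
  · rintro _ ⟨p, hp, rfl⟩
    exact ⟨p, hp, hH p hp⟩
  · rintro _ ⟨p, hp, rfl⟩
    exact ⟨p, hp, hK p hp⟩

theorem exists_isUnit_matrix_of_mem_span {K W : Type*} [Field K] [AddCommGroup W] [Module K W]
    {m : ℕ} {v w : Fin m → W} (hw : LinearIndependent K w)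
    (hwv : ∀ j, w j ∈ Submodule.span K (range v)) :
    ∃ a : Matrix (Fin m) (Fin m) K, IsUnit a ∧ ∀ j, ∑ k, a j k • v k = w j := by
  choose a ha using fun j => (Submodule.mem_span_range_iff_exists_fun K).1 (hwv j)
  refine ⟨Matrix.of a, ?_, ha⟩
  rw [← Matrix.linearIndependent_rows_iff_isUnit]
  -- A linear relation among the rows of `a` would pass to `w`.
  have : w = Fintype.linearCombination K v ∘ (Matrix.of a).row := by
    ext j
    rw [← ha j]
    rfl
  rw [this] at hw
  exact hw.of_comp _

/-- The projection of `ℂⁿ` onto the first `m` coordinates. -/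
noncomputable def initialCoordinates {m n : ℕ} (hmn : m ≤ n) : (Fin n → ℂ) →L[ℝ] (Fin m → ℂ) :=
  ContinuousLinearMap.pi fun j => ContinuousLinearMap.proj (Fin.castLE hmn j)

/-- The inclusion of `ℂᵐ` in `ℂⁿ` as the first `m` coordinates. -/
noncomputable def extendByZero (m n : ℕ) : (Fin m → ℂ) →L[ℝ] (Fin n → ℂ) :=
  ContinuousLinearMap.pi fun i =>
    if h : (i : ℕ) < m then ContinuousLinearMap.proj (⟨i, h⟩ : Fin m) else 0

@[simp]
theorem initialCoordinates_apply {m n : ℕ} (hmn : m ≤ n) (z : Fin n → ℂ) (j : Fin m) :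
    initialCoordinates hmn z j = z (Fin.castLE hmn j) := rfl

theorem initialCoordinates_extendByZero {m n : ℕ} (hmn : m ≤ n) (w : Fin m → ℂ) :
    initialCoordinates hmn (extendByZero m n w) = w := by
  ext j
  simp [extendByZero]

/-! ### Differentials of maximal systems in Spencer coordinates -/

section

variable {n m : ℕ} {M : Type*} [TopologicalSpace M]
  [ChartedSpace (EuclideanSpace ℝ (Fin (2 * n))) M]

theorem hasFDerivAt_comp_symm {u : M → ℂ} {U : Set M} (hU : IsOpen U)
    (hu : ContMDiffOn (𝓡 (2 * n)) 𝓘(ℝ, ℂ) ∞ u U) {φ : OpenPartialHomeomorph M (Fin n → ℂ)}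
    (hφU : φ.source = U)
    (hφ : ContMDiffOn 𝓘(ℝ, Fin n → ℂ) (𝓡 (2 * n)) ∞ φ.symm φ.target)
    {z : Fin n → ℂ} (hz : z ∈ φ.target) :
    HasFDerivAt (u ∘ φ.symm) (show (Fin n → ℂ) →L[ℝ] ℂ from
      (cdiff (n := n) u (φ.symm z)).comp (mfderiv 𝓘(ℝ, Fin n → ℂ) (𝓡 (2 * n)) φ.symm z)) z := by
  have hp : φ.symm z ∈ U := hφU ▸ φ.map_target hz
  have h1 := ((hu.contMDiffAt (hU.mem_nhds hp)).mdifferentiableAt (by simp)).hasMFDerivAt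
  have h2 := ((hφ.contMDiffAt (φ.open_target.mem_nhds hz)).mdifferentiableAt (by simp)).hasMFDerivAt
  exact (h1.comp z h2).hasFDerivAt

variable [IsManifold (𝓡 (2 * n)) ∞ M] {J : AlmostComplexStructure n M} {U : Set M}
  {f h : Fin m → M → ℂ}

theorem IsMaximalSystem.cdiff_mem_span (hf : IsMaximalSystem J U f) {g : M → ℂ}
    (hg : AlmostHolomorphicOn J g U) {p : M} (hp : p ∈ U) :
    cdiff g p ∈ Submodule.span ℂ (range fun j => cdiff (n := n) (f j) p) := by
  have h := hf.maximal g hg p hp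
  have hs : (fun j => cdiff (n := n) (Fin.snoc (α := fun _ => M → ℂ) f g j) p) =
      Fin.snoc (fun j => cdiff (n := n) (f j) p) (cdiff g p) := by
    ext j
    refine Fin.lastCases ?_ (fun j => ?_) j <;> simp
  rw [hs, linearIndependent_finSnoc, not_and_not_right] at h
  exact h (hf.independent p hp)

theorem IsMaximalSystem.exists_hasFDerivAt_comp_symm (hU : IsOpen U)
    (hf : IsMaximalSystem J U f) (hh : IsMaximalSystem J U h) (hmn : m ≤ n)
    {φ : OpenPartialHomeomorph M (Fin n → ℂ)} (hφU : φ.source = U)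
    (hφ : ContMDiffOn 𝓘(ℝ, Fin n → ℂ) (𝓡 (2 * n)) ∞ φ.symm φ.target)
    (hφf : ∀ p ∈ U, ∀ j : Fin m, φ p (Fin.castLE hmn j) = f j p)
    {z : Fin n → ℂ} (hz : z ∈ φ.target) :
    ∃ A : (Fin m → ℂ) ≃L[ℂ] (Fin m → ℂ), HasFDerivAt (jointMap h ∘ φ.symm)
      ((A : (Fin m → ℂ) →L[ℂ] (Fin m → ℂ)).restrictScalars ℝ ∘L initialCoordinates hmn) z := by
  have hp : φ.symm z ∈ U := hφU ▸ φ.map_target hz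
  obtain ⟨a, hau, ha⟩ := exists_isUnit_matrix_of_mem_span (hh.independent _ hp)
    fun j => hf.cdiff_mem_span (hh.almostHolomorphicOn j) hp
  -- In these coordinates `f k` is the `k`-th coordinate function, so `dh_j = ∑ a_jk df_k` becomes
  -- row `j` of `a ∘ π`.
  have hproj : ∀ k, (cdiff (n := n) (f k) (φ.symm z)).comp
      (mfderiv 𝓘(ℝ, Fin n → ℂ) (𝓡 (2 * n)) φ.symm z) =
      (ContinuousLinearMap.proj (Fin.castLE hmn k) : (Fin n → ℂ) →L[ℝ] ℂ) := by
    intro k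
    have h1 := hasFDerivAt_comp_symm hU (hf.almostHolomorphicOn k).1 hφU hφ hz
    have h2 : HasFDerivAt (f k ∘ φ.symm)
        (ContinuousLinearMap.proj (Fin.castLE hmn k) : (Fin n → ℂ) →L[ℝ] ℂ) z := by
      refine (ContinuousLinearMap.hasFDerivAt _).congr_of_eventuallyEq ?_
      filter_upwards [φ.open_target.mem_nhds hz] with y hy
      simp [← hφf _ (hφU ▸ φ.map_target hy) k, φ.right_inv hy]
    exact h1.unique h2
  refine ⟨(Matrix.toLinearEquiv' a hau.invertible).toContinuousLinearEquiv, ?_⟩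
  refine hasFDerivAt_pi'.2 fun j => ?_
  have h1 := hasFDerivAt_comp_symm hU (hh.almostHolomorphicOn j).1 hφU hφ hz
  refine h1.congr_fderiv ?_
  ext v
  symm
  have hv : ∀ k, cdiff (n := n) (f k) (φ.symm z)
      (mfderiv 𝓘(ℝ, Fin n → ℂ) (𝓡 (2 * n)) φ.symm z v) = v (Fin.castLE hmn k) :=
    fun k => DFunLike.congr_fun (hproj k) v
  have hj := DFunLike.congr_fun (ha j) (mfderiv 𝓘(ℝ, Fin n → ℂ) (𝓡 (2 * n)) φ.symm z v)
  refine Eq.trans ?_ hj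
  rw [_root_.sum_apply]
  simp only [_root_.smul_apply, hv]
  rfl

theorem IsMaximalSystem.exists_eventually_eq_comp_symm (hU : IsOpen U)
    (hf : IsMaximalSystem J U f) (hh : IsMaximalSystem J U h) (hmn : m ≤ n)
    {φ : OpenPartialHomeomorph M (Fin n → ℂ)} (hφU : φ.source = U)
    (hφ : ContMDiffOn 𝓘(ℝ, Fin n → ℂ) (𝓡 (2 * n)) ∞ φ.symm φ.target)
    (hφf : ∀ p ∈ U, ∀ j : Fin m, φ p (Fin.castLE hmn j) = f j p)
    {z : Fin n → ℂ} (hz : z ∈ φ.target) :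
    ∃ e : OpenPartialHomeomorph (Fin m → ℂ) (Fin m → ℂ), IsBiholomorphic e ∧
      ∀ᶠ y in 𝓝 z, initialCoordinates hmn y ∈ e.source ∧
        jointMap h (φ.symm y) = e (initialCoordinates hmn y) := by
  refine exists_biholomorphic_factorization (g := jointMap h ∘ φ.symm)
    (initialCoordinates_extendByZero hmn) φ.open_target ?_
    (fun y hy => hf.exists_hasFDerivAt_comp_symm hU hh hmn hφU hφ hφf hy) hz
  refine contDiffOn_pi.2 fun j => ?_
  refine contMDiffOn_iff_contDiffOn.1 ((hh.almostHolomorphicOn j).1.comp hφ fun y hy => ?_)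
  exact hφU ▸ φ.map_target hy

end

theorem lemma3 {n m : ℕ} {M : Type*} [TopologicalSpace M]
    [ChartedSpace (EuclideanSpace ℝ (Fin (2 * n))) M] [IsManifold (𝓡 (2 * n)) ∞ M]
    (J : AlmostComplexStructure n M) (U : Set M) (hU : IsOpen U)
    (f h : Fin m → M → ℂ) (hf : IsSpencerSystem J U f) (hh : IsMaximalSystem J U h) :
    (∀ V : Set M, IsOpen V → V ⊆ U →
      HasConnectedLevelSets (jointMap f) V → HasConnectedLevelSets (jointMap h) V →
      ∃ H : (Fin m → ℂ) → (Fin m → ℂ),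
        IsHolomorphicTransition (jointMap f) (jointMap h) V H) ∧
    (∀ p ∈ U, ∀ W ∈ 𝓝 p, ∃ V : Set M, IsOpen V ∧ p ∈ V ∧ V ⊆ U ∩ W ∧
      HasConnectedLevelSets (jointMap f) V ∧ HasConnectedLevelSets (jointMap h) V ∧
      ∃ H : (Fin m → ℂ) → (Fin m → ℂ),
        IsHolomorphicTransition (jointMap f) (jointMap h) V H) := by
  obtain ⟨hmn, φ, hφU, -, hφ, hφf⟩ := hf.exists_coordinates
  set π := initialCoordinates hmn with hπ
  have hfπ : ∀ p ∈ U, jointMap f p = π (φ p) := fun p hp => funext fun j => (hφf p hp j).symm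
  have hφUt : ∀ {p}, p ∈ U → φ p ∈ φ.target := fun hp => φ.map_source (hφU.symm ▸ hp)
  have hφl : ∀ {p}, p ∈ U → φ.symm (φ p) = p := fun hp => φ.left_inv (hφU.symm ▸ hp)
  have hloc := fun {z} (hz : z ∈ φ.target) =>
    hf.toIsMaximalSystem.exists_eventually_eq_comp_symm hU hh hmn hφU hφ hφf hz
  have hrel : ∀ p ∈ U, BiholomorphicallyRelatedAt (jointMap f) (jointMap h) p := by
    intro p hp
    obtain ⟨e, he, hev⟩ := hloc (hφUt hp)
    refine ⟨e, he, ?_⟩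
    filter_upwards [(φ.continuousAt (hφU.symm ▸ hp)).eventually hev, hU.mem_nhds hp] with q hq hqU
    rw [hfπ q hqU]
    rwa [hφl hqU] at hq
  have hmap : ∀ p ∈ U, Filter.map (jointMap f) (𝓝 p) = 𝓝 (jointMap f p) := by
    intro p hp
    have hev : jointMap f =ᶠ[𝓝 p] π ∘ φ := by
      filter_upwards [hU.mem_nhds hp] with q hq using hfπ q hq
    have hπo : IsOpenMap π := π.isOpenMap fun w => ⟨_, initialCoordinates_extendByZero hmn w⟩
    rw [Filter.map_congr hev, hfπ p hp, ← Filter.map_map, φ.map_nhds_eq (hφU.symm ▸ hp),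
      hπo.map_nhds_eq π.continuous.continuousAt]
  have htrans : ∀ V : Set M, IsOpen V → V ⊆ U →
      HasConnectedLevelSets (jointMap f) V → HasConnectedLevelSets (jointMap h) V →
      ∃ H : (Fin m → ℂ) → (Fin m → ℂ),
        IsHolomorphicTransition (jointMap f) (jointMap h) V H := fun V hVo hVU =>
    exists_isHolomorphicTransition hVo (fun p hp => hrel p (hVU hp)) fun p hp => hmap p (hVU hp)
  refine ⟨htrans, fun p hp W hW => ?_⟩
  obtain ⟨e, -, hev⟩ := hloc (hφUt hp)
  have hWev : ∀ᶠ y in 𝓝 (φ p), φ.symm y ∈ W :=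
    (φ.continuousAt_symm (hφUt hp)).eventually (by rwa [hφl hp])
  -- On this ball a single `e` relates `f` and `h`, and the ball corresponds to a subset of `U ∩ W`.
  obtain ⟨r, hr, hball⟩ := Metric.eventually_nhds_iff_ball.1
    (hev.and (hWev.and (φ.open_target.mem_nhds (hφUt hp))))
  set B := Metric.ball (φ p) r with hB
  have hBt : B ⊆ φ.target := fun y hy => (hball y hy).2.2
  have hBU : φ.symm '' B ⊆ U := by
    rintro _ ⟨y, hy, rfl⟩
    exact hφU ▸ φ.map_target (hBt hy)
  have hfB : ∀ y ∈ B, jointMap f (φ.symm y) = π y := fun y hy => by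
    rw [hfπ _ (hBU (mem_image_of_mem _ hy)), φ.right_inv (hBt hy)]
  have hfc : HasConnectedLevelSets (jointMap f) (φ.symm '' B) := by
    intro c
    have hc : φ.symm '' B ∩ jointMap f ⁻¹' {c} = φ.symm '' (B ∩ π ⁻¹' {c}) := by
      ext q
      constructor
      · rintro ⟨⟨y, hy, rfl⟩, hq⟩
        exact ⟨y, ⟨hy, (hfB y hy).symm.trans hq⟩, rfl⟩
      · rintro ⟨y, ⟨hy, hyc⟩, rfl⟩
        exact ⟨⟨y, hy, rfl⟩, (hfB y hy).trans hyc⟩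
    rw [hc]
    refine IsPreconnected.image ?_ _ (φ.continuousOn_symm.mono (inter_subset_left.trans hBt))
    -- Level sets of `f` become slices of a ball by affine subspaces.
    exact ((convex_ball _ _).inter ((convex_singleton c).linear_preimage
      π.toLinearMap)).isPreconnected
  have hhc : HasConnectedLevelSets (jointMap h) (φ.symm '' B) := by
    intro c
    rcases (φ.symm '' B ∩ jointMap h ⁻¹' {c}).eq_empty_or_nonempty with h0 | ⟨_, ⟨y, hy, rfl⟩, hyc⟩
    · rw [h0]
      exact isPreconnected_empty
    -- Injectivity of `e` makes each nonempty level set of `h` a level set of `f`.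
    · have hc : φ.symm '' B ∩ jointMap h ⁻¹' {c} = φ.symm '' B ∩ jointMap f ⁻¹' {π y} := by
        have hy' := (hball y hy).1
        have hyc' : jointMap h (φ.symm y) = c := hyc
        ext q
        refine and_congr_right ?_
        rintro ⟨x, hx, rfl⟩
        have hx' := (hball x hx).1
        rw [mem_preimage, mem_preimage, mem_singleton_iff, mem_singleton_iff, hfB x hx, ← hyc',
          hx'.2, hy'.2, e.injOn.eq_iff hx'.1 hy'.1]
      rw [hc]
      exact hfc _
  have hVo : IsOpen (φ.symm '' B) :=
    φ.symm.isOpen_image_of_subset_source Metric.isOpen_ball hBt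
  refine ⟨_, hVo, ⟨φ p, Metric.mem_ball_self hr, hφl hp⟩, subset_inter hBU ?_, hfc, hhc,
    htrans _ hVo hBU hfc hhc⟩
  rintro _ ⟨y, hy, rfl⟩
  exact (hball y hy).2.1
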